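/- Fix $p\in[1,\infty)$ and $n\in\mathbb N$, write $\mathbb Z_-=\{\dots,-1,0\}$, let $(\Omega,\mathcal F,\mathbb P)$ be a probability space and let $\mathbf Z=(\mathbf Z_t)_{t\in\mathbb Z_-}$ be an $\mathbb R^n$-valued stochastic process on it. Let $H\colon(\mathbb R^n)^{\mathbb Z_-}\to\mathbb R$ be a functional, measurable for the product Borel $\sigma$-algebra, such that $H(\mathbf Z)\in L^p(\Omega,\mathcal F,\mathbb P)$. Let $\sigma\colon\mathbb R\to\mathbb R$ be non-constant, continuous and bounded; applied to vectors, $\sigma$ acts componentwise. Then for every $\varepsilon>0$ there exist $N\in\mathbb N$, $C\in\mathbb R^{N\times n}$, $\boldsymbol\zeta\in\mathbb R^N$, $A\in\mathbb R^{N\times N}$ and $\mathbf W\in\mathbb R^N$ such that the echo state network $$\mathbf x_t=\sigma(A\mathbf x_{t-1}+C\mathbf z_t+\boldsymbol\zeta),\qquad y_t=\mathbf W^\top\mathbf x_t,\qquad t\in\mathbb Z,$$ has the following properties. 1. (Echo state property.) For every input $\mathbf z\in(\mathbb R^n)^{\mathbb Z}$ there is exactly one $\mathbf x\in(\mathbb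 R^N)^{\mathbb Z}$ satisfying the first equation for all $t\in\mathbb Z$. 2. The corresponding filter $U\colon(\mathbb R^n)^{\mathbb Z}\to\mathbb R^{\mathbb Z}$, $U(\mathbf z)_t=y_t$, is causal ($U(\mathbf z)_t=U(\mathbf w)_t$ whenever $\mathbf z_\tau=\mathbf w_\tau$ for all $\tau\le t$) and time-invariant (it commutes with all time shifts). 3. The associated functional $H^{A,C,\boldsymbol\zeta}_{\mathbf W}\colon(\mathbb R^n)^{\mathbb Z_-}\to\mathbb R$, $H^{A,C,\boldsymbol\zeta}_{\mathbf W}(\mathbf z)=U(\mathbf z^e)_0$ for any extension $\mathbf z^e\in(\mathbb R^n)^{\mathbb Z}$ of $\mathbf z$, satisfies $H^{A,C,\boldsymbol\zeta}_{\mathbf W}(\mathbf Z)\in L^p(\Omega,\mathcal F,\mathbb P)$ and $$\|H(\mathbf Z)-H^{A,C,\boldsymbol\zeta}_{\mathbf W}(\mathbf Z)\|_p<\varepsilon,\qquad \|Y\|_p=\mathbb E[|Y|^p]^{1/p}.$$ -/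

import Mathlib

open MeasureTheory
open scoped ENNReal Matrix

/-- The set `ℤ₋ = {…, -1, 0}` of time indices. -/
abbrev NegTime : Type := {t : ℤ // t ≤ 0}

section Filters

variable {E : Type*}

/-- The time delay operator `T_{-τ}`, `T_{-τ}(z)_t = z_{t+τ}`. -/
def timeDelay (τ : ℤ) (z : ℤ → E) : ℤ → E := fun t => z (t + τ)

/-- A filter is causal if its output at time `t` only depends on the inputs up to time `t`. -/
def IsCausal (U : (ℤ → E) → (ℤ → ℝ)) : Prop :=
  ∀ (t : ℤ) (z w : ℤ → E), (∀ τ ≤ t, z τ = w τ) → U z t = U w t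

/-- A filter is time-invariant if it commutes with all time delay operators. -/
def IsTimeInvariant (U : (ℤ → E) → (ℤ → ℝ)) : Prop :=
  ∀ (τ : ℤ) (z : ℤ → E), timeDelay τ (U z) = U (timeDelay τ z)

/-- The extension by zero of a left-infinite sequence to a two-sided sequence. -/
def extendZero [Zero E] (z : NegTime → E) : ℤ → E :=
  fun t => if h : t ≤ 0 then z ⟨t, h⟩ else 0

/-- The functional `H_U(z) = U(zᵉ)_0` associated to a filter `U`, where `zᵉ` is an extension
of `z` to all of `ℤ`. For causal `U` the choice of the extension is irrelevant, see
`filterFunctional_eq`. -/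
def filterFunctional [Zero E] (U : (ℤ → E) → (ℤ → ℝ)) (z : NegTime → E) : ℝ :=
  U (extendZero z) 0

theorem filterFunctional_eq [Zero E] {U : (ℤ → E) → (ℤ → ℝ)} (hU : IsCausal U)
    (z : NegTime → E) (w : ℤ → E) (hw : ∀ t : NegTime, w t = z t) :
    filterFunctional U z = U w 0 := by
  refine hU 0 _ _ fun τ hτ => ?_
  simp only [extendZero, hτ, dif_pos]
  exact (hw ⟨τ, hτ⟩).symm

end Filters

section Reservoirs

variable {X E : Type*}

/-- `x` is a state sequence of the reservoir map `F` for the input `z`: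
`x_t = F(x_{t-1}, z_t)` for all `t ∈ ℤ`. -/
def IsStateSequence (F : X → E → X) (z : ℤ → E) (x : ℤ → X) : Prop :=
  ∀ t : ℤ, x t = F (x (t - 1)) (z t)

/-- The echo state property: every input has exactly one state sequence. -/
def EchoStateProperty (F : X → E → X) : Prop :=
  ∀ z : ℤ → E, ∃! x : ℤ → X, IsStateSequence F z x

/-- The filter `z ↦ y`, `y_t = h(x_t)`, of a reservoir system with the echo state property,
where `x` is the unique state sequence for the input `z`. -/
noncomputable def reservoirFilter (F : X → E → X) (h : X → ℝ) (hF : EchoStateProperty F) :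
    (ℤ → E) → (ℤ → ℝ) :=
  fun z t => h ((hF z).choose t)

end Reservoirs

section EchoStateNetworks

variable {n N : ℕ}

/-- The echo state network reservoir map `(x, z) ↦ σ(A x + C z + ζ)`, with the activation
function `σ` applied componentwise. -/
def esnMap (σ : ℝ → ℝ) (A : Matrix (Fin N) (Fin N) ℝ) (C : Matrix (Fin N) (Fin n) ℝ)
    (ζ : Fin N → ℝ) (x : Fin N → ℝ) (z : Fin n → ℝ) : Fin N → ℝ :=
  fun i => σ ((A *ᵥ x + C *ᵥ z + ζ) i)

/-- The linear readout `x ↦ Wᵀ x`. -/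
def linearReadout (W : Fin N → ℝ) (x : Fin N → ℝ) : ℝ := W ⬝ᵥ x

/-- The filter of an echo state network with the echo state property. -/
noncomputable def esnFilter (σ : ℝ → ℝ) (A : Matrix (Fin N) (Fin N) ℝ)
    (C : Matrix (Fin N) (Fin n) ℝ) (ζ W : Fin N → ℝ)
    (hESP : EchoStateProperty (esnMap σ A C ζ)) : (ℤ → Fin n → ℝ) → (ℤ → ℝ) :=
  reservoirFilter (esnMap σ A C ζ) (linearReadout W) hESP

/-- The functional of an echo state network with the echo state property. -/
noncomputable def esnFunctional (σ : ℝ → ℝ) (A : Matrix (Fin N) (Fin N) ℝ)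
    (C : Matrix (Fin N) (Fin n) ℝ) (ζ W : Fin N → ℝ)
    (hESP : EchoStateProperty (esnMap σ A C ζ)) : (NegTime → Fin n → ℝ) → ℝ :=
  filterFunctional (esnFilter σ A C ζ W hESP)

end EchoStateNetworks

/-! ### Ridge functions of the activation determine finite measures. -/

section Fourier

open scoped FourierTransform

/-! Functionals computed by feed-forward networks with unit delays form a vector space of bounded
functionals of the past. The theorem reduces to its density in `L^p` of the law of the input. A
continuous functional on `L^p` acts on bounded functions as a difference of two finite measures, so
by Hahn–Banach it suffices that network functionals separate finite measures on sequence space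
(`exists_eLpNorm_sub_lt_of_annihilator`, `measure_ext_of_isReservoirFunctional`).

For one layer, a Fourier argument shows that the functions `σ (L x + b)` separate finite measures
(`measure_ext_of_integral_activation`). Depth supplies memory: a neuron fed with the current input
and a delayed approximant of the indicator of `A` detects, in the limit, the joint law of `z 0` and
that indicator. Hence indicators of cylinders one step longer are approximable
(`ReservoirApproximable.indicator_cons`), and cylinders determine a measure.

Feed-forward connections make the connection matrix nilpotent, so the echo state property needs no
contraction condition (`echoStateProperty_of_rank`). -/

theorem integrable_prod_mul_comp_mul {s θ q : ℝ → ℂ} (hs : Measurable s) {M : ℝ}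
    (hM : ∀ v, ‖s v‖ ≤ M) (hθ : AEStronglyMeasurable θ)
    (hθ' : Integrable fun ξ => (ξ⁻¹ : ℝ) • θ ξ) (hq : Integrable q) (hqc : Continuous q) :
    Integrable (fun x : ℝ × ℝ => θ x.1 * (s x.2 * q (x.1 * x.2))) (volume.prod volume) := by
  have hk : Integrable (fun x : ℝ × ℝ => θ x.1 * q (x.1 * x.2)) (volume.prod volume) := by
    rw [integrable_prod_iff]
    · refine ⟨?_, ?_⟩
      · filter_upwards [Measure.ae_ne volume (0 : ℝ)] with ξ hξ
        exact (hq.comp_mul_left' hξ).const_mul _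
      -- The dilation by `ξ` costs a factor `|ξ|⁻¹`; this is why `θ ξ / ξ` must be integrable, and
      -- later why `θ` is chosen to vanish at the origin.
      · refine (hθ'.norm.mul_const (∫ y, ‖q y‖)).congr (ae_of_all _ fun ξ => ?_)
        simp only [norm_mul, integral_const_mul]
        rw [Measure.integral_comp_mul_left (fun y => ‖q y‖) ξ, norm_smul, smul_eq_mul,
          Real.norm_eq_abs]
        ring
    · have hmul : Continuous fun x : ℝ × ℝ => x.1 * x.2 := by fun_prop
      exact hθ.comp_fst.mul (hqc.comp hmul).aestronglyMeasurable
  refine (hk.bdd_mul (c := M) (f := fun x : ℝ × ℝ => s x.2)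
    (hs.comp measurable_snd).aestronglyMeasurable
    (ae_of_all _ fun x => hM x.2)).congr (ae_of_all _ fun x => ?_)
  simp only
  ring

theorem integral_mul_fourier_comp_mul {θ G : ℝ → ℂ} (hθ : Integrable θ) (hG : Integrable G)
    (v : ℝ) : ∫ ξ, θ ξ * 𝓕 G (ξ * v) = ∫ η, G η * 𝓕 θ (η * v) := by
  have h := VectorFourier.integral_fourierIntegral_smul_eq_flip (μ := (volume : Measure ℝ))
    (ν := (volume : Measure ℝ)) (L := v • LinearMap.mul ℝ ℝ) (f := G) (g := θ)
    Real.continuous_fourierChar (by simp; fun_prop) hG hθ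
  have e1 : ∀ ξ, 𝓕 G (ξ * v) =
      VectorFourier.fourierIntegral 𝐞 volume (v • LinearMap.mul ℝ ℝ) G ξ := fun ξ => by
    rw [Real.fourier_real_eq, VectorFourier.fourierIntegral]
    refine integral_congr_ae (ae_of_all _ fun y => ?_)
    simp only [LinearMap.smul_apply, LinearMap.mul_apply', smul_eq_mul]
    ring_nf
  have e2 : ∀ η, 𝓕 θ (η * v) =
      VectorFourier.fourierIntegral 𝐞 volume (v • LinearMap.mul ℝ ℝ).flip θ η := fun η => by
    rw [Real.fourier_real_eq, VectorFourier.fourierIntegral]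
    refine integral_congr_ae (ae_of_all _ fun y => ?_)
    simp only [LinearMap.flip_apply, LinearMap.smul_apply, LinearMap.mul_apply', smul_eq_mul]
    ring_nf
  simp only [e1, e2]
  simpa only [smul_eq_mul, mul_comm] using h

/-- A transfer identity: dilating the Fourier transform of `G` against `θ` is the same as dilating
the Fourier transform of `θ` against `G`. -/
theorem integral_mul_integral_fourier_comp_mul {s θ G : ℝ → ℂ} (hs : Measurable s) {M : ℝ}
    (hM : ∀ v, ‖s v‖ ≤ M) (hθ : Integrable θ) (hθ' : Integrable fun ξ => (ξ⁻¹ : ℝ) • θ ξ)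
    (hG : Integrable G) (hG' : Integrable fun η => (η⁻¹ : ℝ) • G η)
    (hFθ : Integrable (𝓕 θ)) (hFG : Integrable (𝓕 G)) :
    ∫ ξ, θ ξ * ∫ v, s v * 𝓕 G (ξ * v) = ∫ η, G η * ∫ v, s v * 𝓕 θ (η * v) := by
  have hcont : ∀ f : ℝ → ℂ, Integrable f → Continuous (𝓕 f) := fun f hf =>
    VectorFourier.fourierIntegral_continuous Real.continuous_fourierChar (by fun_prop) hf
  simp only [← integral_const_mul]
  rw [integral_integral_swap (f := fun ξ v => θ ξ * (s v * 𝓕 G (ξ * v)))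
      (integrable_prod_mul_comp_mul hs hM hθ.1 hθ' hFG (hcont _ hG)),
    integral_integral_swap (f := fun ξ v => G ξ * (s v * 𝓕 θ (ξ * v)))
      (integrable_prod_mul_comp_mul hs hM hG.1 hG' hFθ (hcont _ hθ))]
  congr 1 with v
  have := integral_mul_fourier_comp_mul hθ hG v
  calc _ = s v * ∫ ξ, θ ξ * 𝓕 G (ξ * v) := by
        rw [← integral_const_mul]; congr 1 with ξ; ring
    _ = _ := by rw [this, ← integral_const_mul]; congr 1 with ξ; ring

/-- Multiplication by the Fourier transform of `ν` becomes convolution with `ν`. -/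
theorem fourier_mul_integral_exp (ν : Measure ℝ) [IsFiniteMeasure ν] {g : ℝ → ℂ}
    (hg : Integrable g) (x : ℝ) :
    𝓕 (fun η => g η * ∫ t, (𝐞 (η * t) : ℂ) ∂ν) x = ∫ t, 𝓕 g (x - t) ∂ν := by
  simp only [Real.fourier_real_eq, Circle.smul_def, smul_eq_mul]
  have hint : Integrable (fun p : ℝ × ℝ => (𝐞 (-(p.1 * (x - p.2))) : ℂ) * g p.1)
      (volume.prod ν) := by
    refine (hg.comp_fst ν).bdd_mul (c := 1) ?_ (ae_of_all _ fun p => (Circle.norm_coe _).le)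
    exact Continuous.aestronglyMeasurable (by fun_prop)
  rw [← integral_integral_swap (f := fun v t => (𝐞 (-(v * (x - t))) : ℂ) * g v) hint]
  congr 1 with v
  rw [← integral_const_mul, ← integral_const_mul]
  congr 1 with t
  rw [show -(v * (x - t)) = -(v * x) + v * t by ring, AddChar.map_add_eq_mul, Circle.coe_mul]
  ring

theorem integrable_prod_comp_sub (ν : Measure ℝ) [IsFiniteMeasure ν] {q : ℝ → ℂ}
    (hq : Integrable q) (hqc : Continuous q) :
    Integrable (fun p : ℝ × ℝ => q (p.1 - p.2)) (volume.prod ν) := by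
  rw [integrable_prod_iff' (Continuous.aestronglyMeasurable (by fun_prop))]
  refine ⟨ae_of_all _ fun t => hq.comp_sub_right t, ?_⟩
  simp only [integral_sub_right_eq_self (fun x => ‖q x‖)]
  exact integrable_const _

/-- The substitution `v = ξ⁻¹ t + b` moves the translation by `t` from `q` to `s`. Afterwards `ν`
enters only through its integrals against ridge functions of `s`. -/
theorem integral_mul_integral_comp_sub (ν : Measure ℝ) [IsFiniteMeasure ν] {s q : ℝ → ℂ}
    (hs : Measurable s) {M : ℝ} (hM : ∀ v, ‖s v‖ ≤ M)
    (hq : Integrable q) (hqc : Continuous q) {ξ : ℝ} (hξ : ξ ≠ 0) :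
    ∫ v, s v * ∫ t, q (ξ * v - t) ∂ν = ∫ b, (∫ t, s (ξ⁻¹ * t + b) ∂ν) * q (ξ * b) := by
  simp only [← integral_const_mul, ← integral_mul_const]
  have h1 : Integrable (fun p : ℝ × ℝ => s p.1 * q (ξ * p.1 - p.2)) (volume.prod ν) := by
    refine Integrable.bdd_mul (c := M) ?_ (hs.comp measurable_fst).aestronglyMeasurable
      (ae_of_all _ fun p => hM p.1)
    rw [integrable_prod_iff' (Continuous.aestronglyMeasurable (by fun_prop))]
    refine ⟨ae_of_all _ fun t => (hq.comp_sub_right t).comp_mul_left' hξ, ?_⟩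
    refine (integrable_const (|ξ⁻¹| • ∫ x, ‖q x‖)).congr (ae_of_all _ fun t => ?_)
    simp only
    rw [Measure.integral_comp_mul_left (fun x => ‖q (x - t)‖),
      integral_sub_right_eq_self (fun x => ‖q x‖)]
  have h2 : Integrable (fun p : ℝ × ℝ => s (ξ⁻¹ * p.2 + p.1) * q (ξ * p.1)) (volume.prod ν) := by
    refine Integrable.bdd_mul (c := M) ((hq.comp_mul_left' hξ).comp_fst ν)
      (hs.comp (by fun_prop)).aestronglyMeasurable (ae_of_all _ fun p => hM _)
  rw [integral_integral_swap (f := fun v t => s v * q (ξ * v - t)) h1,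
    integral_integral_swap (f := fun b t => s (ξ⁻¹ * t + b) * q (ξ * b)) h2]
  congr 1 with t
  rw [← integral_add_left_eq_self _ (ξ⁻¹ * t)]
  congr 1 with b
  rw [mul_add, mul_inv_cancel_left₀ hξ, add_sub_cancel_left]

/-- The Gaussian centred at `a`. -/
noncomputable def gaussianShift (a : ℝ) (x : ℝ) : ℂ := Complex.exp (-Real.pi * (x - a) ^ 2)

theorem continuous_gaussianShift (a : ℝ) : Continuous (gaussianShift a) := by
  unfold gaussianShift; fun_prop

theorem gaussianShift_add (a x : ℝ) : gaussianShift a (x + a) = gaussianShift 0 x := by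
  simp [gaussianShift]

theorem integrable_gaussianShift (a : ℝ) : Integrable (gaussianShift a) := by
  have h := (integrable_cexp_quadratic (b := (Real.pi : ℂ)) (by simpa using Real.pi_pos)
    0 0).comp_sub_right a
  refine h.congr (ae_of_all _ fun x => ?_)
  simp [gaussianShift]

theorem integral_gaussianShift_zero : ∫ x, gaussianShift 0 x = 1 := by
  have h := congrFun (fourier_gaussian_pi (b := 1) (by simp)) 0
  rw [Real.fourier_real_eq_integral_exp_smul] at h
  simpa [gaussianShift] using h

/-- A difference of two modulated Gaussians, which vanishes at the origin. -/
noncomputable def gaussianMod (a : ℝ) (x : ℝ) : ℂ :=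
  Complex.exp (-Real.pi * x ^ 2 + 2 * Real.pi * (Complex.I * a) * x) -
    Complex.exp (-Real.pi * x ^ 2)

theorem integrable_gaussianMod (a : ℝ) : Integrable (gaussianMod a) := by
  have h := fun c : ℂ =>
    integrable_cexp_quadratic (b := (Real.pi : ℂ)) (by simpa using Real.pi_pos) c 0
  refine ((h (2 * Real.pi * (Complex.I * a))).sub (h 0)).congr (ae_of_all _ fun x => ?_)
  simp [gaussianMod]

theorem integrable_inv_smul_gaussianMod (a : ℝ) :
    Integrable fun x => (x⁻¹ : ℝ) • gaussianMod a x := by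
  have h : Integrable fun x : ℝ => ‖gaussianShift 0 x‖ * (2 * Real.pi * |a|) :=
    (integrable_gaussianShift 0).norm.mul_const _
  refine h.mono' ((by fun_prop : Measurable fun x : ℝ => x⁻¹).aestronglyMeasurable.smul
    (integrable_gaussianMod a).1) (ae_of_all _ fun x => ?_)
  have e : gaussianMod a x =
      gaussianShift 0 x * (Complex.exp (Complex.I * ((2 * Real.pi * a * x : ℝ) : ℂ)) - 1) := by
    rw [gaussianMod, gaussianShift, mul_sub, ← Complex.exp_add, mul_one]
    push_cast
    ring_nf
  rw [e, norm_smul, norm_mul]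
  -- The bound `|exp (iy) - 1| ≤ |y|` provides the factor `|x|` that cancels `x⁻¹`.
  have := Real.norm_exp_I_mul_ofReal_sub_one_le (x := 2 * Real.pi * a * x)
  rcases eq_or_ne x 0 with rfl | hx
  · simp
    positivity
  calc _ ≤ ‖x⁻¹‖ * (‖gaussianShift 0 x‖ * ‖2 * Real.pi * a * x‖) := by gcongr
    _ = _ := by
      simp only [norm_mul, norm_inv, Real.norm_eq_abs, abs_of_pos Real.pi_pos, Nat.abs_ofNat]
      have := abs_pos.2 hx
      field_simp

theorem fourier_gaussianMod (a : ℝ) :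
    𝓕 (gaussianMod a) = fun w => gaussianShift a w - gaussianShift 0 w := by
  have h (c : ℂ) : Integrable fun x : ℝ => Complex.exp (-Real.pi * x ^ 2 + 2 * Real.pi * c * x) :=
    by simpa using integrable_cexp_quadratic (b := (Real.pi : ℂ)) (by simpa using Real.pi_pos)
        (2 * Real.pi * c) 0
  have key (c : ℂ) (w : ℝ) :
      ∫ x : ℝ, 𝐞 (-(x * w)) • Complex.exp (-Real.pi * x ^ 2 + 2 * Real.pi * c * x) =
        Complex.exp (-Real.pi * (w + Complex.I * c) ^ 2) := by
    have := congrFun (fourier_gaussian_pi' (b := 1) (by simp) c) w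
    rw [Real.fourier_real_eq] at this
    simpa using this
  have hi (c : ℂ) (w : ℝ) : Integrable fun x : ℝ =>
      𝐞 (-(x * w)) • Complex.exp (-Real.pi * x ^ 2 + 2 * Real.pi * c * x) := by
    have h := (Real.fourierIntegral_convergent_iff (μ := (volume : Measure ℝ)) w).2 (h c)
    simpa [mul_comm] using h
  ext w
  rw [Real.fourier_real_eq]
  have e : ∀ x : ℝ, gaussianMod a x =
      Complex.exp (-Real.pi * x ^ 2 + 2 * Real.pi * (Complex.I * a) * x) -
        Complex.exp (-Real.pi * x ^ 2 + 2 * Real.pi * 0 * x) := fun x => by simp [gaussianMod]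
  simp only [e, smul_sub]
  rw [integral_sub (hi _ w) (hi _ w), key, key, gaussianShift, gaussianShift, ← mul_assoc,
    Complex.I_mul_I]
  congr 3 <;> simp [sub_eq_add_neg]

theorem continuous_integral_fourierChar (ν : Measure ℝ) [IsFiniteMeasure ν] :
    Continuous fun η : ℝ => ∫ t, (𝐞 (η * t) : ℂ) ∂ν := by
  refine continuous_of_dominated (bound := fun _ => 1) ?_ ?_ (integrable_const _) ?_
  · exact fun x => Continuous.aestronglyMeasurable (by fun_prop)
  · exact fun x => ae_of_all _ fun t => (Circle.norm_coe _).le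
  · exact ae_of_all _ fun t => by fun_prop

theorem norm_integral_fourierChar_le (ν : Measure ℝ) [IsFiniteMeasure ν] (η : ℝ) :
    ‖∫ t, (𝐞 (η * t) : ℂ) ∂ν‖ ≤ ν.real Set.univ := by
  simpa using norm_integral_le_of_norm_le_const (μ := ν) (C := 1)
    (ae_of_all _ fun t => (Circle.norm_coe (𝐞 (η * t))).le)

/-- The transfer identity for `G η = η g(η) ∫ 𝐞(η t) dν`: the left side tests the Fourier transform
of `ν` against `g`, while the right side knows `ν` only through ridge integrals. The factor `η`
keeps `G η / η` integrable. -/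
theorem integral_fourierChar_mul_integral_fourier_comp_mul (ν : Measure ℝ)
    [IsFiniteMeasure ν] {s : ℝ → ℂ} (hs : Measurable s) {M : ℝ} (hM : ∀ v, ‖s v‖ ≤ M) {g : ℝ → ℝ}
    (hg : ContDiff ℝ ((⊤ : ℕ∞) : WithTop ℕ∞) g)
    (hgc : HasCompactSupport g) {θ : ℝ → ℂ}
    (hθ : Integrable θ) (hθ' : Integrable fun ξ => (ξ⁻¹ : ℝ) • θ ξ) (hFθ : Integrable (𝓕 θ)) :
    ∫ η : ℝ, ((η * g η : ℝ) * ∫ t, (𝐞 (η * t) : ℂ) ∂ν) * ∫ v, s v * 𝓕 θ (η * v) =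
      ∫ ξ, θ ξ * ∫ b, (∫ t, s (ξ⁻¹ * t + b) ∂ν) *
        𝓕 (fun η : ℝ => ((η * g η : ℝ) : ℂ)) (ξ * b) := by
  have hF := continuous_integral_fourierChar ν
  have hcont : ∀ f : ℝ → ℂ, Integrable f → Continuous (𝓕 f) := fun f hf =>
    VectorFourier.fourierIntegral_continuous Real.continuous_fourierChar (by fun_prop) hf
  have hgs : HasCompactSupport fun η : ℝ => ((η * g η : ℝ) : ℂ) :=
    (hgc.mul_left (f := fun η : ℝ => η)).comp_left (g := fun x : ℝ => (x : ℂ)) Complex.ofReal_zero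
  have hgd : ContDiff ℝ ((⊤ : ℕ∞) : WithTop ℕ∞) fun η : ℝ => ((η * g η : ℝ) : ℂ) :=
    Complex.ofRealCLM.contDiff.comp (contDiff_id.mul hg)
  have hgi : Integrable fun η : ℝ => ((η * g η : ℝ) : ℂ) :=
    hgd.continuous.integrable_of_hasCompactSupport hgs
  have hq : Integrable (𝓕 fun η : ℝ => ((η * g η : ℝ) : ℂ)) := by
    have := (𝓕 (hgs.toSchwartzMap hgd)).integrable (μ := volume)
    rwa [SchwartzMap.fourier_coe] at this
  have hqc := hcont _ hgi
  have hb (f : ℝ → ℂ) (hf : Integrable f) :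
      Integrable fun η : ℝ => f η * ∫ t, (𝐞 (η * t) : ℂ) ∂ν :=
    hf.mul_bdd (c := ν.real Set.univ) hF.aestronglyMeasurable
      (ae_of_all _ (norm_integral_fourierChar_le ν))
  have hG' : Integrable fun η : ℝ =>
      (η⁻¹ : ℝ) • (((η * g η : ℝ) : ℂ) * ∫ t, (𝐞 (η * t) : ℂ) ∂ν) := by
    have hgi' : Integrable fun η : ℝ => (g η : ℂ) :=
      (hg.continuous.integrable_of_hasCompactSupport hgc).ofReal
    refine (hb _ hgi').congr ?_
    filter_upwards [Measure.ae_ne volume (0 : ℝ)] with η hη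
    have : (η : ℂ) ≠ 0 := by exact_mod_cast hη
    simp only [Complex.real_smul]
    push_cast
    field_simp
  have hFG : 𝓕 (fun η : ℝ => ((η * g η : ℝ) : ℂ) * ∫ t, (𝐞 (η * t) : ℂ) ∂ν) =
      fun x => ∫ t, 𝓕 (fun η : ℝ => ((η * g η : ℝ) : ℂ)) (x - t) ∂ν := by
    ext x
    exact fourier_mul_integral_exp ν hgi x
  rw [← integral_mul_integral_fourier_comp_mul hs hM hθ hθ' (hb _ hgi) hG' hFθ
    (by rw [hFG]; exact (integrable_prod_comp_sub ν hq hqc).integral_prod_left), hFG]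
  refine integral_congr_ae ?_
  filter_upwards [Measure.ae_ne volume (0 : ℝ)] with ξ hξ
  rw [integral_mul_integral_comp_sub ν hs hM hq hqc hξ]

/-- By the preceding identity both measures give the same integral against every test function `g`
supported in `(0, ∞)`; the substitution `u = η v` absorbs the factor `η`. So the product vanishes
almost everywhere there, and everywhere by continuity. -/
theorem sub_integral_fourierChar_mul_integral_gaussian_eq_zero {ν₁ ν₂ : Measure ℝ}
    [IsFiniteMeasure ν₁] [IsFiniteMeasure ν₂] {s : ℝ → ℂ}
    (hs : Continuous s) {M : ℝ} (hM : ∀ v, ‖s v‖ ≤ M)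
    (h : ∀ l b, ∫ t, s (l * t + b) ∂ν₁ = ∫ t, s (l * t + b) ∂ν₂) (a : ℝ) {η : ℝ} (hη : 0 < η) :
    ((∫ t, (𝐞 (η * t) : ℂ) ∂ν₁) - ∫ t, (𝐞 (η * t) : ℂ) ∂ν₂) *
      ∫ u, s (η⁻¹ * u) * (gaussianShift a u - gaussianShift 0 u) = 0 := by
  have hFθ := fourier_gaussianMod a
  have hK : Integrable fun u => gaussianShift a u - gaussianShift 0 u :=
    (integrable_gaussianShift a).sub (integrable_gaussianShift 0)
  set c : ℝ → ℂ := fun η => ∫ u, s (η⁻¹ * u) * (gaussianShift a u - gaussianShift 0 u) with hc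
  set f : ℝ → ℂ := fun η =>
    ((∫ t, (𝐞 (η * t) : ℂ) ∂ν₁) - ∫ t, (𝐞 (η * t) : ℂ) ∂ν₂) * c η with hf
  have hcc : ContinuousOn c (Set.Ioi 0) := by
    refine continuousOn_of_dominated
      (bound := fun u => M * ‖gaussianShift a u - gaussianShift 0 u‖) ?_ ?_ (hK.norm.const_mul _) ?_
    · exact fun x _ => (hs.comp (by fun_prop)).aestronglyMeasurable.mul hK.1
    · exact fun x _ => ae_of_all _ fun u => by rw [norm_mul]; gcongr; exact hM _
    · refine ae_of_all _ fun u => ?_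
      refine ContinuousOn.mul (hs.comp_continuousOn ?_) continuousOn_const
      exact ContinuousOn.mul (continuousOn_id.inv₀ fun x hx => ne_of_gt hx) continuousOn_const
  have hfc : ContinuousOn f (Set.Ioi 0) :=
    ((continuous_integral_fourierChar ν₁).sub
      (continuous_integral_fourierChar ν₂)).continuousOn.mul hcc
  have hae : ∀ᵐ x, x ∈ Set.Ioi (0 : ℝ) → f x = 0 := by
    refine isOpen_Ioi.ae_eq_zero_of_integral_contDiff_smul_eq_zero
      (hfc.locallyIntegrableOn measurableSet_Ioi) fun g hg hgc hgs => ?_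
    have key := fun (ν : Measure ℝ) [IsFiniteMeasure ν] =>
      integral_fourierChar_mul_integral_fourier_comp_mul ν hs.measurable hM hg hgc
      (integrable_gaussianMod a) (integrable_inv_smul_gaussianMod a) (by rw [hFθ]; exact hK)
    have e := (key ν₁).trans ((by simp only [h]) : _ = _) |>.trans (key ν₂).symm
    have hcm : StronglyMeasurable c := by
      refine StronglyMeasurable.integral_prod_right (f := fun η u =>
        s (η⁻¹ * u) * (gaussianShift a u - gaussianShift 0 u)) ?_
      refine Measurable.stronglyMeasurable ?_
      have := (continuous_gaussianShift a).measurable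
      have := (continuous_gaussianShift 0).measurable
      have := hs.measurable
      simp only [Function.uncurry_def]
      fun_prop
    have hcb : ∀ η, ‖c η‖ ≤ ∫ u, M * ‖gaussianShift a u - gaussianShift 0 u‖ := fun η =>
      norm_integral_le_of_norm_le (hK.norm.const_mul M)
        (ae_of_all _ fun u => by rw [norm_mul]; gcongr; exact hM _)
    have hi (ν : Measure ℝ) [IsFiniteMeasure ν] :
        Integrable fun η => g η • ((∫ t, (𝐞 (η * t) : ℂ) ∂ν) * c η) := by
      have hgi : Integrable g := hg.continuous.integrable_of_hasCompactSupport hgc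
      have h1 := (hgi.ofReal (𝕜 := ℂ)).mul_bdd
        (continuous_integral_fourierChar ν).aestronglyMeasurable
        (ae_of_all _ (norm_integral_fourierChar_le ν))
      refine (h1.mul_bdd hcm.aestronglyMeasurable (ae_of_all _ hcb)).congr (ae_of_all _ fun η => ?_)
      simp only [Complex.real_smul]
      exact mul_assoc _ _ _
    have hC (ν : Measure ℝ) [IsFiniteMeasure ν] (η : ℝ) :
        ((η * g η : ℝ) * ∫ t, (𝐞 (η * t) : ℂ) ∂ν) * ∫ v, s v * 𝓕 (gaussianMod a) (η * v) =
          g η • ((∫ t, (𝐞 (η * t) : ℂ) ∂ν) * c η) := by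
      by_cases hη : 0 < η
      · have : ∫ v, s v * 𝓕 (gaussianMod a) (η * v) = (η : ℂ)⁻¹ * c η := by
          have := Measure.integral_comp_mul_left
            (fun u => s (η⁻¹ * u) * 𝓕 (gaussianMod a) u) η
          simp only [inv_mul_cancel_left₀ hη.ne', abs_of_pos (inv_pos.2 hη), hFθ] at this
          rw [hFθ, this, Complex.real_smul, Complex.ofReal_inv]
        have h0 : (η : ℂ) ≠ 0 := by exact_mod_cast hη.ne'
        rw [this, Complex.real_smul]
        push_cast
        field_simp
      · have : g η = 0 := by
          by_contra h0
          exact hη (hgs (subset_tsupport _ h0))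
        simp [this]
    simp only [hC] at e
    simp only [hf, sub_mul, smul_sub]
    rw [integral_sub (hi ν₁) (hi ν₂), e, sub_self]
  have := Measure.eqOn_open_of_ae_eq (f := f) (g := fun _ => 0) (μ := volume)
    ((ae_restrict_iff' measurableSet_Ioi).2 hae) isOpen_Ioi hfc continuousOn_const
  exact this hη

/-- Taking `a = η x`, the hypothesis equates the Gaussian averages of `s` at scale `η⁻¹` around `x`
and around `0`. Letting `η → ∞` recovers the point values. -/
theorem eq_of_integral_gaussianShift_sub_eq_zero {s : ℝ → ℂ} (hs : Continuous s) {M : ℝ}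
    (hM : ∀ v, ‖s v‖ ≤ M)
    (h : ∀ a η : ℝ, 0 < η → ∫ u, s (η⁻¹ * u) * (gaussianShift a u - gaussianShift 0 u) = 0)
    (x : ℝ) : s x = s 0 := by
  have hi (r a : ℝ) : Integrable fun u => s (r * u) * gaussianShift a u :=
    (integrable_gaussianShift a).bdd_mul (hs.comp (by fun_prop)).aestronglyMeasurable
      (ae_of_all _ fun u => hM _)
  have e (η : ℝ) (hη : 0 < η) : ∫ u, s (η⁻¹ * u + x) * gaussianShift 0 u =
      ∫ u, s (η⁻¹ * u + 0) * gaussianShift 0 u := by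
    have h1 := h (η * x) η hη
    simp only [mul_sub] at h1
    rw [integral_sub (hi _ _) (hi _ _), sub_eq_zero] at h1
    rw [← integral_add_right_eq_self _ (η * x)] at h1
    simpa only [gaussianShift_add, mul_add, inv_mul_cancel_left₀ hη.ne', add_zero] using h1
  have lim (y : ℝ) : Filter.Tendsto
      (fun n : ℕ => ∫ u, s (((n : ℝ) + 1)⁻¹ * u + y) * gaussianShift 0 u)
      Filter.atTop (nhds (s y)) := by
    have : s y = ∫ u, s y * gaussianShift 0 u := by
      rw [integral_const_mul, integral_gaussianShift_zero, mul_one]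
    rw [this]
    refine tendsto_integral_of_dominated_convergence (fun u => M * ‖gaussianShift 0 u‖) ?_ ?_ ?_ ?_
    · exact fun n => ((hs.comp (by fun_prop)).mul (continuous_gaussianShift 0)).aestronglyMeasurable
    · exact (integrable_gaussianShift 0).norm.const_mul _
    · exact fun n => ae_of_all _ fun u => by rw [norm_mul]; gcongr; exact hM _
    · refine ae_of_all _ fun u => Filter.Tendsto.mul_const _ ((hs.tendsto y).comp ?_)
      have := tendsto_one_div_add_atTop_nhds_zero_nat (𝕜 := ℝ)
      simpa using (this.mul_const u).add_const y
  refine tendsto_nhds_unique (lim x) ((lim 0).congr fun n => ?_)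
  exact (e _ (by positivity)).symm

/-- The ridge hypothesis survives dilation of the measures. Dilating by `x / η` makes frequency `η >
0` probe frequency `x` of any sign, so one `x` with different transforms kills the Gaussian factor
for all `a` and `η`, forcing `s` to be constant. -/
theorem integral_fourierChar_eq {ν₁ ν₂ : Measure ℝ} [IsFiniteMeasure ν₁] [IsFiniteMeasure ν₂]
    {s : ℝ → ℂ} (hs : Continuous s) {M : ℝ} (hM : ∀ v, ‖s v‖ ≤ M) (hc : ¬ ∃ c, ∀ x, s x = c)
    (h : ∀ l b, ∫ t, s (l * t + b) ∂ν₁ = ∫ t, s (l * t + b) ∂ν₂) (x : ℝ) :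
    ∫ t, (𝐞 (x * t) : ℂ) ∂ν₁ = ∫ t, (𝐞 (x * t) : ℂ) ∂ν₂ := by
  by_contra hne
  refine hc ⟨s 0, eq_of_integral_gaussianShift_sub_eq_zero hs hM fun a η hη => ?_⟩
  have hmap (ν : Measure ℝ) (f : ℝ → ℂ) (hf : Continuous f) :
      ∫ t, f t ∂(ν.map fun t => x / η * t) = ∫ t, f (x / η * t) ∂ν :=
    integral_map (by fun_prop) hf.aestronglyMeasurable
  have key := sub_integral_fourierChar_mul_integral_gaussian_eq_zero
    (ν₁ := ν₁.map fun t => x / η * t)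
    (ν₂ := ν₂.map fun t => x / η * t) hs hM (fun l b => by
      rw [hmap _ _ (by fun_prop), hmap _ _ (by fun_prop)]
      simpa only [mul_assoc] using h (l * (x / η)) b) a hη
  rw [hmap _ _ (by fun_prop), hmap _ _ (by fun_prop)] at key
  simp only [← mul_assoc, mul_div_cancel₀ _ hη.ne'] at key
  exact (mul_eq_zero.1 key).resolve_left (sub_ne_zero.2 hne)

/-- A finite measure is determined by its integrals against the ridge functions `σ (L x + b)` of a
continuous, bounded and non-constant activation function. -/
theorem measure_ext_of_integral_activation {F : Type*} [NormedAddCommGroup F] [NormedSpace ℝ F]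
    [MeasurableSpace F] [BorelSpace F] [SecondCountableTopology F] [CompleteSpace F]
    {ν₁ ν₂ : Measure F} [IsFiniteMeasure ν₁] [IsFiniteMeasure ν₂] {σ : ℝ → ℝ} (hσ : Continuous σ)
    (hb : Bornology.IsBounded (Set.range σ)) (hc : ¬ ∃ c, ∀ x, σ x = c)
    (h : ∀ (L : StrongDual ℝ F) (b : ℝ), ∫ x, σ (L x + b) ∂ν₁ = ∫ x, σ (L x + b) ∂ν₂) :
    ν₁ = ν₂ := by
  obtain ⟨M, hM⟩ := hb.exists_norm_le
  refine Measure.ext_of_charFunDual (funext fun L => ?_)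
  have hmap (ν : Measure F) (f : ℝ → ℂ) (hf : Continuous f) :
      ∫ t, f t ∂(ν.map L) = ∫ t, f (L t) ∂ν :=
    integral_map (by fun_prop) hf.aestronglyMeasurable
  -- The frequency `(2π)⁻¹` cancels the `2π` in `Real.fourierChar`, which `charFunDual` does not
  -- carry. The slope `l` is absorbed into the functional `l • L`.
  have key := integral_fourierChar_eq (ν₁ := ν₁.map L) (ν₂ := ν₂.map L)
    (s := fun x => (σ x : ℂ)) (by fun_prop) (M := M)
    (fun v => by simpa using hM _ (Set.mem_range_self v))
    (fun ⟨c, h⟩ => hc ⟨σ 0, fun x => by exact_mod_cast (h x).trans (h 0).symm⟩)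
    (fun l b => by
      rw [hmap _ _ (by fun_prop), hmap _ _ (by fun_prop), integral_complex_ofReal,
        integral_complex_ofReal]
      exact congrArg _ (h (l • L) b)) (2 * Real.pi)⁻¹
  rw [hmap _ _ (by fun_prop), hmap _ _ (by fun_prop)] at key
  have : (2 * Real.pi) ≠ 0 := by positivity
  simpa only [charFunDual_apply, Real.fourierChar_apply, mul_inv_cancel_left₀ this] using key

end Fourier

/-! ### Functionals on `Lp` as differences of measures, and a density criterion. -/

section Dual

variable {X : Type*} [MeasurableSpace X] {μ : Measure X} [IsFiniteMeasure μ] {p : ℝ≥0∞}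

theorem tendsto_eLpNorm_sub_of_bounded (hp : 1 ≤ p) (hp' : p ≠ ∞) {f : ℕ → X → ℝ} {g : X → ℝ}
    (hf : ∀ n, AEStronglyMeasurable (f n) μ) (hg : MemLp g p μ) {M : ℝ} (hM : ∀ n x, ‖f n x‖ ≤ M)
    (h : ∀ᵐ x ∂μ, Filter.Tendsto (fun n => f n x) Filter.atTop (nhds (g x))) :
    Filter.Tendsto (fun n => eLpNorm (f n - g) p μ) Filter.atTop (nhds 0) := by
  refine tendsto_Lp_finite_of_tendsto_ae hp hp' hf hg ?_ h
  -- The level `M + 1` exceeds every value, so the tails in the definition of uniform integrability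
  -- are empty.
  refine unifIntegrable_of hp hp' hf fun ε hε => ⟨(M + 1).toNNReal, fun n => ?_⟩
  have : {x | (M + 1).toNNReal ≤ ‖f n x‖₊} = ∅ := by
    ext x
    simp only [Set.mem_ofPred_eq, Set.mem_empty_iff_false, iff_false, not_le]
    rw [← NNReal.coe_lt_coe]
    calc (‖f n x‖₊ : ℝ) = ‖f n x‖ := rfl
      _ < M + 1 := by linarith [hM n x]
      _ ≤ _ := Real.le_coe_toNNReal _
  simp [this]

open scoped Classical in
/-- The signed measure `s ↦ Λ 1ₛ` of a continuous linear functional on `Lp`. -/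
noncomputable def signedMeasureOfDual [Fact (1 ≤ p)] (hp : p ≠ ∞) (Λ : StrongDual ℝ (Lp ℝ p μ)) :
    SignedMeasure X where
  measureOf' s := if h : MeasurableSet s then Λ (indicatorConstLp p h (measure_ne_top μ s) 1) else 0
  empty' := by simp
  not_measurable' s hs := by simp [hs]
  m_iUnion' f hf hd := by
    have hU := MeasurableSet.iUnion hf
    have hs (t : Finset ℕ) : MeasurableSet (⋃ i ∈ t, f i) := t.measurableSet_biUnion fun i _ => hf i
    have hsum (t : Finset ℕ) : ∑ i ∈ t, indicatorConstLp p (hf i) (measure_ne_top μ _) (1 : ℝ) =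
        indicatorConstLp p (hs t) (measure_ne_top μ _) 1 := by
      classical
      induction t using Finset.induction_on with
      | empty => simp
      | insert a t ha ih =>
        rw [Finset.sum_insert ha, ih, ← indicatorConstLp_disjoint_union]
        · simp only [Finset.mem_insert, Set.iUnion_iUnion_eq_or_left]
        · simp only [Set.disjoint_iUnion_right]
          exact fun i hi => hd fun e => ha (e ▸ hi)
    simp only [hf, hU, dif_pos]
    rw [HasSum]
    simp only [← map_sum, hsum]
    refine (Λ.continuous.tendsto _).comp (tendsto_indicatorConstLp_set hp ?_)
    have hsub (t : Finset ℕ) : (⋃ i ∈ t, f i) ⊆ ⋃ i, f i :=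
      Set.iUnion₂_subset fun i _ => Set.subset_iUnion f i
    have e (t : Finset ℕ) : μ (symmDiff (⋃ i ∈ t, f i) (⋃ i, f i)) =
        μ (⋃ i, f i) - ∑ i ∈ t, μ (f i) := by
      rw [symmDiff_of_le (hsub t), measure_sdiff (hsub t) (hs t).nullMeasurableSet
        (measure_ne_top μ _), measure_biUnion_finset (fun i _ j _ h => hd h) fun i _ => hf i]
    simp only [e]
    have h1 : HasSum (fun i => μ (f i)) (μ (⋃ i, f i)) := by
      rw [measure_iUnion hd hf]
      exact ENNReal.summable.hasSum
    have := ENNReal.Tendsto.sub (tendsto_const_nhds (x := μ (⋃ i, f i))) h1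
      (Or.inl (measure_ne_top μ _))
    rwa [tsub_self] at this

theorem signedMeasureOfDual_apply [Fact (1 ≤ p)] (hp : p ≠ ∞) (Λ : StrongDual ℝ (Lp ℝ p μ))
    {s : Set X} (hs : MeasurableSet s) :
    signedMeasureOfDual hp Λ s = Λ (indicatorConstLp p hs (measure_ne_top μ s) 1) := by
  exact dif_pos hs

/-- The two measures are the Jordan parts of the signed measure, absolutely continuous because `Λ`
kills indicators of null sets. The formula passes from indicators to simple functions by linearity
and to bounded functions by dominated convergence. -/
theorem exists_measures_of_dual [Fact (1 ≤ p)] (hp : p ≠ ∞) (Λ : StrongDual ℝ (Lp ℝ p μ)) :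
    ∃ ν₁ ν₂ : Measure X, IsFiniteMeasure ν₁ ∧ IsFiniteMeasure ν₂ ∧ ν₁ ≪ μ ∧ ν₂ ≪ μ ∧
      ∀ (f : X → ℝ) (_ : Measurable f) (M : ℝ) (_ : ∀ x, ‖f x‖ ≤ M) (hf : MemLp f p μ),
        Λ (hf.toLp f) = ∫ x, f x ∂ν₁ - ∫ x, f x ∂ν₂ := by
  set m := signedMeasureOfDual hp Λ with hm
  set ν₁ := m.toJordanDecomposition.posPart
  set ν₂ := m.toJordanDecomposition.negPart
  have hac : m.totalVariation ≪ μ := by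
    rw [← VectorMeasure.ennrealToMeasure_toENNRealVectorMeasure μ,
      ← SignedMeasure.absolutelyContinuous_ennreal_iff]
    refine VectorMeasure.AbsolutelyContinuous.mk fun s hs h0 => ?_
    rw [Measure.toENNRealVectorMeasure_apply_measurable hs] at h0
    rw [hm, signedMeasureOfDual_apply hp Λ hs, ← norm_eq_zero]
    have : indicatorConstLp p hs (measure_ne_top μ s) (1 : ℝ) = 0 := by
      rw [← indicatorConstLp_empty (c := (1 : ℝ)), indicatorConstLp_inj _ _ _ _ one_ne_zero]
      exact ae_eq_empty.2 h0
    simp [this]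
  have hac' := (m.totalVariation_absolutelyContinuous_iff μ).1 hac
  have simple (f : SimpleFunc X ℝ) :
      ∀ hf : MemLp f p μ, Λ (hf.toLp f) = ∫ x, f x ∂ν₁ - ∫ x, f x ∂ν₂ := by
    have hi (f : SimpleFunc X ℝ) (ν : Measure X) [IsFiniteMeasure ν] : Integrable f ν :=
      f.integrable_of_isFiniteMeasure
    induction f using SimpleFunc.induction with
    | const c hs =>
      intro hf
      rename_i s
      have e : hf.toLp _ = c • indicatorConstLp p hs (measure_ne_top μ s) (1 : ℝ) := by
        rw [indicatorConstLp, ← MemLp.toLp_const_smul, MemLp.toLp_eq_toLp_iff]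
        refine ae_of_all _ fun x => ?_
        by_cases hx : x ∈ s <;> simp [hx]
      rw [e, map_smul, ← signedMeasureOfDual_apply hp Λ hs, ← hm,
        SignedMeasure.apply_eq_posPart_real_sub_negPart_real m hs]
      have hI (ν : Measure X) : ∫ x, (SimpleFunc.piecewise s hs (SimpleFunc.const X c)
          (SimpleFunc.const X 0)) x ∂ν = c * ν.real s := by
        classical
        rw [SimpleFunc.coe_piecewise, SimpleFunc.coe_const, SimpleFunc.coe_const,
          Function.const_zero, Set.piecewise_eq_indicator, integral_indicator hs]
        simp [mul_comm]
      rw [hI, hI, smul_eq_mul, mul_sub]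
    | add hd h1 h2 =>
      rename_i f g
      intro hf
      have hf1 : MemLp f p μ := f.memLp_of_isFiniteMeasure p μ
      have hf2 : MemLp g p μ := g.memLp_of_isFiniteMeasure p μ
      have : hf.toLp _ = hf1.toLp f + hf2.toLp g := by
        rw [← MemLp.toLp_add]; rfl
      rw [this, map_add, h1, h2]
      simp only [SimpleFunc.coe_add, Pi.add_apply]
      rw [integral_add (hi f _) (hi g _), integral_add (hi f _) (hi g _)]
      ring
  refine ⟨ν₁, ν₂, inferInstance, inferInstance, hac'.1, hac'.2, fun f hfm M hM hf => ?_⟩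
  have hsm := hfm.stronglyMeasurable
  set φ := hsm.approxBounded M
  have hφ : ∀ n x, ‖φ n x‖ ≤ M := fun n x =>
    hsm.norm_approxBounded_le ((norm_nonneg _).trans (hM x)) n x
  have hlim : ∀ x, Filter.Tendsto (fun n => φ n x) Filter.atTop (nhds (f x)) := fun x =>
    hsm.tendsto_approxBounded_of_norm_le (hM x)
  have hφL : ∀ n, MemLp (φ n) p μ := fun n => (φ n).memLp_of_isFiniteMeasure p μ
  have hLp : Filter.Tendsto (fun n => (hφL n).toLp (φ n)) Filter.atTop (nhds (hf.toLp f)) := by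
    rw [Lp.tendsto_Lp_iff_tendsto_eLpNorm'']
    exact tendsto_eLpNorm_sub_of_bounded Fact.out hp (fun n => (φ n).aestronglyMeasurable) hf hφ
      (ae_of_all _ hlim)
  have hI (ν : Measure X) [IsFiniteMeasure ν] :
      Filter.Tendsto (fun n => ∫ x, φ n x ∂ν) Filter.atTop (nhds (∫ x, f x ∂ν)) :=
    tendsto_integral_of_dominated_convergence (fun _ => M)
      (fun n => (φ n).aestronglyMeasurable) (integrable_const _)
      (fun n => ae_of_all _ (hφ n)) (ae_of_all _ hlim)
  refine tendsto_nhds_unique ((Λ.continuous.tendsto _).comp hLp) ?_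
  simpa only [Function.comp_def, simple] using (hI ν₁).sub (hI ν₂)

/-- `f` is in the `Lp`-closure of a space `V` of bounded functions if any two finite measures that
agree on `V` agree on `f`. -/
theorem exists_eLpNorm_sub_lt_of_annihilator (hp : 1 ≤ p) (hp' : p ≠ ∞) (V : Submodule ℝ (X → ℝ))
    (hV : ∀ g ∈ V, Measurable g ∧ ∃ M, ∀ x, ‖g x‖ ≤ M) {f : X → ℝ} (hf : Measurable f) {M : ℝ}
    (hM : ∀ x, ‖f x‖ ≤ M)
    (h : ∀ ν₁ ν₂ : Measure X, IsFiniteMeasure ν₁ → IsFiniteMeasure ν₂ → ν₁ ≪ μ → ν₂ ≪ μ →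
      (∀ g ∈ V, ∫ x, g x ∂ν₁ = ∫ x, g x ∂ν₂) → ∫ x, f x ∂ν₁ = ∫ x, f x ∂ν₂)
    {ε : ℝ≥0∞} (hε : 0 < ε) : ∃ g ∈ V, eLpNorm (f - g) p μ < ε := by
  have : Fact (1 ≤ p) := ⟨hp⟩
  have hbdd (g : X → ℝ) (hg : Measurable g) (hM : ∃ M, ∀ x, ‖g x‖ ≤ M) : MemLp g p μ :=
    .of_bound hg.aestronglyMeasurable hM.choose (ae_of_all _ hM.choose_spec)
  have hVL (g : V) : MemLp (g : X → ℝ) p μ := hbdd g (hV g g.2).1 (hV g g.2).2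
  have hfL : MemLp f p μ := hbdd f hf ⟨M, hM⟩
  let ι : V →ₗ[ℝ] Lp ℝ p μ :=
    { toFun g := (hVL g).toLp g
      map_add' g g' := MemLp.toLp_add (hVL g) (hVL g')
      map_smul' c g := MemLp.toLp_const_smul c (hVL g) }
  by_contra hcon
  push Not at hcon
  have hnot : hfL.toLp f ∉ closure (LinearMap.range ι : Set (Lp ℝ p μ)) := by
    intro hmem
    obtain ⟨_, ⟨g, rfl⟩, hg⟩ := EMetric.mem_closure_iff.1 hmem ε hε
    change edist (hfL.toLp f) ((hVL g).toLp g) < ε at hg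
    rw [Lp.edist_toLp_toLp] at hg
    exact absurd hg (not_lt.2 (hcon g g.2))
  obtain ⟨Λ, u, hΛ, hu⟩ := geometric_hahn_banach_closed_point
    (LinearMap.range ι).convex.closure isClosed_closure hnot
  have hzero (g : V) : Λ (ι g) = 0 := by
    by_contra h0
    -- A functional bounded above on a subspace vanishes there: this multiple would take the value
    -- `u + 1`, above the bound `u`.
    have := hΛ (ι (((u + 1) / Λ (ι g)) • g)) (subset_closure ⟨_, rfl⟩)
    rw [map_smul, map_smul, smul_eq_mul, div_mul_cancel₀ _ h0] at this
    linarith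
  have hu0 : 0 < u := by simpa using hΛ 0 (subset_closure (zero_mem _))
  obtain ⟨ν₁, ν₂, i1, i2, ac1, ac2, hν⟩ := exists_measures_of_dual hp' Λ
  have := h ν₁ ν₂ i1 i2 ac1 ac2 fun g hg => by
    obtain ⟨hgm, M, hM⟩ := hV g hg
    have := hν g hgm M hM (hVL ⟨g, hg⟩)
    exact sub_eq_zero.1 (this.symm.trans (hzero ⟨g, hg⟩))
  rw [hν f hf M hM, this, sub_self] at hu
  linarith

end Dual

/-! ### Density of the network functionals. -/

/-- The functionals of sequences of past inputs (`z k` is the input `k` steps ago) that are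
computed by feed-forward networks of neurons with unit delays. -/
inductive IsReservoirFunctional {n : ℕ} (σ : ℝ → ℝ) : ((ℕ → Fin n → ℝ) → ℝ) → Prop
  | zero : IsReservoirFunctional σ 0
  | add {f g : (ℕ → Fin n → ℝ) → ℝ} : IsReservoirFunctional σ f → IsReservoirFunctional σ g →
      IsReservoirFunctional σ (f + g)
  | smul (a : ℝ) {f : (ℕ → Fin n → ℝ) → ℝ} : IsReservoirFunctional σ f →
      IsReservoirFunctional σ (a • f)
  | node {f : (ℕ → Fin n → ℝ) → ℝ} (c : Fin n → ℝ) (b : ℝ) : IsReservoirFunctional σ f →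
      IsReservoirFunctional σ fun z => σ (f (fun k => z (k + 1)) + c ⬝ᵥ z 0 + b)

section Density

variable {n : ℕ} {σ : ℝ → ℝ}

theorem IsReservoirFunctional.measurable (hσ : Measurable σ) {f : (ℕ → Fin n → ℝ) → ℝ}
    (hf : IsReservoirFunctional σ f) : Measurable f := by
  induction hf with
  | zero => exact measurable_zero
  | add _ _ h1 h2 => exact h1.add h2
  | smul a _ h => exact h.const_smul a
  | node c b _ h =>
    refine hσ.comp (((h.comp (by fun_prop)).add ?_).add_const b)
    unfold dotProduct
    fun_prop

theorem IsReservoirFunctional.exists_norm_le (hσ : Bornology.IsBounded (Set.range σ))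
    {f : (ℕ → Fin n → ℝ) → ℝ} (hf : IsReservoirFunctional σ f) : ∃ M, ∀ z, ‖f z‖ ≤ M := by
  induction hf with
  | zero => exact ⟨0, by simp⟩
  | add _ _ h1 h2 =>
    obtain ⟨M, hM⟩ := h1
    obtain ⟨M', hM'⟩ := h2
    exact ⟨M + M', fun z => (norm_add_le _ _).trans (add_le_add (hM z) (hM' z))⟩
  | smul a _ h =>
    obtain ⟨M, hM⟩ := h
    refine ⟨‖a‖ * M, fun z => ?_⟩
    rw [Pi.smul_apply, norm_smul]
    gcongr
    exact hM z
  | node c b _ _ =>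
    obtain ⟨M, hM⟩ := hσ.exists_norm_le
    exact ⟨M, fun z => hM _ (Set.mem_range_self _)⟩

/-- The space of reservoir functionals. -/
def reservoirSubmodule (n : ℕ) (σ : ℝ → ℝ) : Submodule ℝ ((ℕ → Fin n → ℝ) → ℝ) where
  carrier := {f | IsReservoirFunctional σ f}
  zero_mem' := .zero
  add_mem' := .add
  smul_mem' a _ := .smul a

/-- `f` is an `Lp`-limit of reservoir functionals for every finite measure. -/
def ReservoirApproximable (σ : ℝ → ℝ) (p : ℝ≥0∞) (f : (ℕ → Fin n → ℝ) → ℝ) : Prop :=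
  ∀ (μ : Measure (ℕ → Fin n → ℝ)) [IsFiniteMeasure μ] (ε : ℝ≥0∞), 0 < ε →
    ∃ g, IsReservoirFunctional σ g ∧ eLpNorm (f - g) p μ < ε

variable {p : ℝ≥0∞}

theorem ReservoirApproximable.exists_seq {f : (ℕ → Fin n → ℝ) → ℝ}
    (hf : ReservoirApproximable σ p f) (μ : Measure (ℕ → Fin n → ℝ)) [IsFiniteMeasure μ] :
    ∃ g : ℕ → (ℕ → Fin n → ℝ) → ℝ, (∀ k, IsReservoirFunctional σ (g k)) ∧
      Filter.Tendsto (fun k => eLpNorm (g k - f) p μ) Filter.atTop (nhds 0) := by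
  choose g hg hlt using fun k : ℕ => hf μ ((k : ℝ≥0∞) + 1)⁻¹ (by simp)
  refine ⟨g, hg, tendsto_of_tendsto_of_tendsto_of_le_of_le tendsto_const_nhds
    (h := fun k : ℕ => ((k : ℝ≥0∞) + 1)⁻¹) ?_ (fun _ => zero_le) fun k => ?_⟩
  · have := (Filter.tendsto_add_atTop_iff_nat 1).2 ENNReal.tendsto_inv_nat_nhds_zero
    simpa using this
  · simp only
    rw [eLpNorm_sub_comm]
    exact (hlt k).le

theorem ReservoirApproximable.integral_eq (hp : 1 ≤ p) (hp' : p ≠ ∞) (hσ : Measurable σ)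
    (hb : Bornology.IsBounded (Set.range σ)) {f : (ℕ → Fin n → ℝ) → ℝ} (hfm : Measurable f)
    (hf : ReservoirApproximable σ p f) (ν₁ ν₂ : Measure (ℕ → Fin n → ℝ)) [IsFiniteMeasure ν₁]
    [IsFiniteMeasure ν₂]
    (h : ∀ g, IsReservoirFunctional σ g → ∫ z, g z ∂ν₁ = ∫ z, g z ∂ν₂) :
    ∫ z, f z ∂ν₁ = ∫ z, f z ∂ν₂ := by
  -- Approximating under `ν₁ + ν₂` yields one sequence that converges under both measures.
  obtain ⟨g, hg, hlim⟩ := hf.exists_seq (ν₁ + ν₂)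
  have hgi (k : ℕ) (ν : Measure (ℕ → Fin n → ℝ)) [IsFiniteMeasure ν] : MemLp (g k) p ν := by
    obtain ⟨M, hM⟩ := (hg k).exists_norm_le hb
    exact .of_bound ((hg k).measurable hσ).aestronglyMeasurable M (ae_of_all _ hM)
  have hfL : MemLp f p (ν₁ + ν₂) := by
    obtain ⟨k, hk⟩ := (hlim.eventually (gt_mem_nhds ENNReal.zero_lt_top)).exists
    have : MemLp (g k - f) p (ν₁ + ν₂) :=
      ⟨((hg k).measurable hσ).aestronglyMeasurable.sub hfm.aestronglyMeasurable, hk⟩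
    simpa using (hgi k (ν₁ + ν₂)).sub this
  have key (ν : Measure (ℕ → Fin n → ℝ)) [IsFiniteMeasure ν] (hν : ν ≤ ν₁ + ν₂) :
      Filter.Tendsto (fun k => ∫ z, g k z ∂ν) Filter.atTop (nhds (∫ z, f z ∂ν)) := by
    refine tendsto_integral_of_L1' f hfm.aestronglyMeasurable
      (Filter.Eventually.of_forall fun k => (hgi k ν).integrable hp) ?_
    have hc : ν Set.univ ^ (1 / (1 : ℝ≥0∞).toReal - 1 / p.toReal) ≠ ∞ := by
      refine ENNReal.rpow_ne_top_of_nonneg ?_ (measure_ne_top _ _)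
      have : 1 ≤ p.toReal := by
        rw [← ENNReal.toReal_one]
        exact ENNReal.toReal_mono hp' hp
      rw [ENNReal.toReal_one, div_one, sub_nonneg]
      exact div_le_one_of_le₀ this (by positivity)
    refine tendsto_of_tendsto_of_tendsto_of_le_of_le tendsto_const_nhds
      (h := fun k => eLpNorm (g k - f) p (ν₁ + ν₂) *
        ν Set.univ ^ (1 / (1 : ℝ≥0∞).toReal - 1 / p.toReal)) ?_ (fun _ => zero_le) fun k => ?_
    · have := ENNReal.Tendsto.mul_const hlim (Or.inr hc)
      rwa [zero_mul] at this
    · refine (eLpNorm_le_eLpNorm_mul_rpow_measure_univ hp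
        (((hg k).measurable hσ).sub hfm).aestronglyMeasurable).trans ?_
      exact mul_le_mul_left (eLpNorm_mono_measure _ hν) _
  refine tendsto_nhds_unique (key ν₁ (Measure.le_add_right le_rfl)) ?_
  simpa only [fun k => h _ (hg k)] using key ν₂ (Measure.le_add_left le_rfl)

/-- By the annihilator criterion it suffices that two measures agreeing on network functionals give
`Φ` the same law. A ridge function of `Φ` has the indicator of `A` inside `σ`; replacing it by
approximants gives genuine nodes, and bounded convergence passes to the limit. -/
theorem ReservoirApproximable.indicator_cons (hp : 1 ≤ p) (hp' : p ≠ ∞) (hσ : Continuous σ)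
    (hb : Bornology.IsBounded (Set.range σ)) (hc : ¬ ∃ c, ∀ x, σ x = c)
    {A : Set (ℕ → Fin n → ℝ)} (hA : MeasurableSet A)
    (hf : ReservoirApproximable σ p (A.indicator 1)) {B : Set (Fin n → ℝ)} (hB : MeasurableSet B) :
    ReservoirApproximable σ p
      ({z : ℕ → Fin n → ℝ | z 0 ∈ B ∧ (fun k => z (k + 1)) ∈ A}.indicator 1) := by
  intro μ _ ε hε
  have hT : Measurable fun (z : ℕ → Fin n → ℝ) k => z (k + 1) := by fun_prop
  have h1A : Measurable (A.indicator (1 : (ℕ → Fin n → ℝ) → ℝ)) := measurable_one.indicator hA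
  set Φ : (ℕ → Fin n → ℝ) → (Fin n → ℝ) × ℝ := fun z => (z 0, A.indicator 1 fun k => z (k + 1))
  have hΦ : Measurable Φ := (measurable_pi_apply 0).prodMk (h1A.comp hT)
  have hset : {z : ℕ → Fin n → ℝ | z 0 ∈ B ∧ (fun k => z (k + 1)) ∈ A} = Φ ⁻¹' (B ×ˢ {1}) := by
    ext z
    by_cases hz : (fun k => z (k + 1)) ∈ A <;> simp [Φ, hz]
  have hms : MeasurableSet (B ×ˢ ({1} : Set ℝ)) := hB.prod (measurableSet_singleton 1)
  rw [hset]
  obtain ⟨M, hM⟩ := hb.exists_norm_le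
  refine exists_eLpNorm_sub_lt_of_annihilator hp hp' (reservoirSubmodule n σ)
    (fun g hg => ⟨hg.measurable hσ.measurable, hg.exists_norm_le hb⟩)
    (measurable_one.indicator (hΦ hms)) (M := 1) (fun z => ?_) (fun ν₁ ν₂ _ _ ac₁ ac₂ h => ?_) hε
  · exact (norm_indicator_le_norm_self _ _).trans (by simp)
  suffices ν₁.map Φ = ν₂.map Φ by
    rw [integral_indicator_one (hΦ hms), integral_indicator_one (hΦ hms), measureReal_def,
      measureReal_def, ← Measure.map_apply hΦ hms, ← Measure.map_apply hΦ hms, this]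
  refine measure_ext_of_integral_activation hσ hb hc fun L b => ?_
  rw [integral_map hΦ.aemeasurable (Continuous.aestronglyMeasurable (by fun_prop)),
    integral_map hΦ.aemeasurable (Continuous.aestronglyMeasurable (by fun_prop))]
  have hL (z : ℕ → Fin n → ℝ) : L (Φ z) = L (0, 1) * A.indicator 1 (fun k => z (k + 1)) +
      (fun i => L (Pi.single i 1, 0)) ⬝ᵥ z 0 := by
    have h0 : L (Φ z) = L (z 0, 0) + A.indicator 1 (fun k => z (k + 1)) * L (0, 1) := by
      rw [← smul_eq_mul, ← map_smul, ← map_add]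
      simp [Φ]
    have h1 := LinearMap.pi_apply_eq_sum_univ
      ((L : ((Fin n → ℝ) × ℝ) →ₗ[ℝ] ℝ) ∘ₗ LinearMap.inl ℝ (Fin n → ℝ) ℝ) (z 0)
    simp only [LinearMap.coe_comp, Function.comp_apply, LinearMap.inl_apply,
      ContinuousLinearMap.coe_coe, smul_eq_mul] at h1
    rw [h0, h1, add_comm, mul_comm, dotProduct]
    congr 1
    refine Finset.sum_congr rfl fun i _ => ?_
    rw [mul_comm]
    congr 3
    ext j
    simp [Pi.single_apply, eq_comm]
  -- The approximation is needed under the law of the shifted sequence, hence the quantification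
  -- over all measures in `ReservoirApproximable`. Convergence almost everywhere along a subsequence
  -- then transfers to any `ν ≪ μ`.
  obtain ⟨g, hg, hlim⟩ := hf.exists_seq (μ.map fun z k => z (k + 1))
  obtain ⟨k, -, hae⟩ := (tendstoInMeasure_of_tendsto_eLpNorm (by positivity)
    (fun k => ((hg k).measurable hσ.measurable).aestronglyMeasurable)
    h1A.aestronglyMeasurable hlim).exists_seq_tendsto_ae
  have hae := ae_of_ae_map hT.aemeasurable hae
  have key (ν : Measure (ℕ → Fin n → ℝ)) [IsFiniteMeasure ν] (hν : ν ≪ μ) :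
      Filter.Tendsto (fun m => ∫ z, σ ((L (0, 1) • g (k m)) (fun k => z (k + 1)) +
        (fun i => L (Pi.single i 1, 0)) ⬝ᵥ z 0 + b) ∂ν) Filter.atTop
        (nhds (∫ z, σ (L (Φ z) + b) ∂ν)) := by
    refine tendsto_integral_of_dominated_convergence (fun _ => M) (fun m => ?_)
      (integrable_const _) (fun m => ae_of_all _ fun z => hM _ (Set.mem_range_self _)) ?_
    · exact ((((hg (k m)).smul _).node _ b).measurable hσ.measurable).aestronglyMeasurable
    · filter_upwards [hν hae] with z hz
      rw [hL]
      exact (hσ.tendsto _).comp (((hz.const_mul _).add_const _).add_const b)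
  refine tendsto_nhds_unique (key ν₁ ac₁) ?_
  simpa only [fun m => h _ (((hg (k m)).smul (L (0, 1))).node (fun i => L (Pi.single i 1, 0)) b)]
    using key ν₂ ac₂

theorem reservoirApproximable_indicator_cylinder (hp : 1 ≤ p) (hp' : p ≠ ∞) (hσ : Continuous σ)
    (hb : Bornology.IsBounded (Set.range σ)) (hc : ¬ ∃ c, ∀ x, σ x = c) (K : ℕ)
    (B : ℕ → Set (Fin n → ℝ)) (hB : ∀ k, MeasurableSet (B k)) :
    ReservoirApproximable σ p ({z : ℕ → Fin n → ℝ | ∀ k < K, z k ∈ B k}.indicator 1) := by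
  induction K generalizing B with
  | zero =>
    intro μ _ ε hε
    obtain ⟨b, hb⟩ : ∃ b, σ b ≠ 0 := by
      by_contra! h
      exact hc ⟨0, h⟩
    -- The constant `1` is a rescaled neuron without inputs, with a bias `b` at which `σ` is
    -- nonzero.
    refine ⟨_, (IsReservoirFunctional.zero.node 0 b).smul (σ b)⁻¹, ?_⟩
    convert hε
    rw [← eLpNorm_zero (p := p) (μ := μ) (α := ℕ → Fin n → ℝ) (ε := ℝ)]
    congr 1
    ext z
    simp [hb]
  | succ K ih =>
    have hm : MeasurableSet {z : ℕ → Fin n → ℝ | ∀ k < K, z k ∈ B (k + 1)} := by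
      simp only [Set.ofPred_forall]
      exact .iInter fun k => .iInter fun _ => measurable_pi_apply k (hB (k + 1))
    convert (ih (fun k => B (k + 1)) fun k => hB _).indicator_cons hp hp' hσ hb hc hm (hB 0) using 3
    ext z
    exact Nat.forall_lt_succ_left

theorem measure_ext_of_isReservoirFunctional (hp : 1 ≤ p) (hp' : p ≠ ∞) (hσ : Continuous σ)
    (hb : Bornology.IsBounded (Set.range σ)) (hc : ¬ ∃ c, ∀ x, σ x = c)
    {ν₁ ν₂ : Measure (ℕ → Fin n → ℝ)} [IsFiniteMeasure ν₁] [IsFiniteMeasure ν₂]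
    (h : ∀ g, IsReservoirFunctional σ g → ∫ z, g z ∂ν₁ = ∫ z, g z ∂ν₂) : ν₁ = ν₂ := by
  have hcyl (K : ℕ) (B : ℕ → Set (Fin n → ℝ)) (hB : ∀ k, MeasurableSet (B k)) :
      ν₁ {z | ∀ k < K, z k ∈ B k} = ν₂ {z | ∀ k < K, z k ∈ B k} := by
    have hm : MeasurableSet {z : ℕ → Fin n → ℝ | ∀ k < K, z k ∈ B k} := by
      simp only [Set.ofPred_forall]
      exact .iInter fun k => .iInter fun _ => measurable_pi_apply k (hB k)
    have := (reservoirApproximable_indicator_cylinder hp hp' hσ hb hc K B hB).integral_eq hp hp'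
      hσ.measurable hb (measurable_one.indicator hm) ν₁ ν₂ h
    rw [integral_indicator_one hm, integral_indicator_one hm] at this
    exact (measureReal_eq_measureReal_iff).1 this
  refine ext_of_generate_finite _ generateFrom_squareCylinders.symm
    (isPiSystem_squareCylinders (fun _ => MeasurableSpace.isPiSystem_measurableSet)
      fun _ => by simp) ?_
    (by simpa using hcyl 0 (fun _ => Set.univ) (by simp))
  rintro _ ⟨t, B, hB, rfl⟩
  classical
  -- A condition on finitely many coordinates becomes one on an initial segment by imposing nothing
  -- at the missing indices.
  have e : (t : Set ℕ).pi B =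
      {z | ∀ k < t.sup id + 1, z k ∈ if k ∈ t then B k else Set.univ} := by
    ext z
    refine ⟨fun hz k _ => ?_, fun hz k hk => ?_⟩
    · split_ifs with hk
      · exact hz k hk
      · trivial
    · have := hz k (Nat.lt_succ_of_le (Finset.le_sup (f := id) hk))
      rwa [if_pos (Finset.mem_coe.1 hk)] at this
  rw [e]
  refine hcyl _ _ fun k => ?_
  split_ifs
  · exact hB k trivial
  · exact .univ

theorem exists_isReservoirFunctional_eLpNorm_sub_lt (hp : 1 ≤ p) (hp' : p ≠ ∞)
    (hσ : Continuous σ)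
    (hb : Bornology.IsBounded (Set.range σ)) (hc : ¬ ∃ c, ∀ x, σ x = c)
    {μ : Measure (ℕ → Fin n → ℝ)} [IsFiniteMeasure μ] {f : (ℕ → Fin n → ℝ) → ℝ}
    (hf : MemLp f p μ) {ε : ℝ≥0∞} (hε : ε ≠ 0) :
    ∃ g, IsReservoirFunctional σ g ∧ eLpNorm (f - g) p μ < ε := by
  -- The criterion handles bounded targets only, so half of `ε` is spent on a simple function.
  obtain ⟨s, hs, -⟩ := hf.exists_simpleFunc_eLpNorm_sub_lt hp' (ENNReal.half_pos hε).ne'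
  obtain ⟨M, hM⟩ := s.exists_forall_norm_le
  obtain ⟨g, hg, hlt⟩ := exists_eLpNorm_sub_lt_of_annihilator (μ := μ) hp hp'
    (reservoirSubmodule n σ)
    (fun g hg => ⟨hg.measurable hσ.measurable, hg.exists_norm_le hb⟩) s.measurable hM
    (fun ν₁ ν₂ _ _ _ _ h => by rw [measure_ext_of_isReservoirFunctional hp hp' hσ hb hc h])
    (ENNReal.half_pos hε)
  refine ⟨g, hg, ?_⟩
  calc eLpNorm (f - g) p μ = eLpNorm ((f - ⇑s) + (⇑s - g)) p μ := by rw [sub_add_sub_cancel]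
    _ ≤ eLpNorm (f - ⇑s) p μ + eLpNorm (⇑s - g) p μ := eLpNorm_add_le
        (hf.1.sub s.aestronglyMeasurable) (s.aestronglyMeasurable.sub
          (IsReservoirFunctional.measurable hσ.measurable hg).aestronglyMeasurable) hp
    _ < ε / 2 + ε / 2 := ENNReal.add_lt_add hs hlt
    _ = ε := ENNReal.add_halves ε

end Density

/-! ### Realization by echo state networks. -/

/-- `g` is a linear readout of an echo state network whose connections strictly increase a rank. -/
def IsRealizable {n : ℕ} (σ : ℝ → ℝ) (g : (ℕ → Fin n → ℝ) → ℝ) : Prop :=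
  ∃ (ι : Type) (_ : Fintype ι) (r : ι → ℕ) (A : Matrix ι ι ℝ) (C : Matrix ι (Fin n) ℝ)
    (ζ W : ι → ℝ), (∀ i j, A i j ≠ 0 → r j < r i) ∧
      ∀ (z : ℤ → Fin n → ℝ) (x : ℤ → ι → ℝ),
        (∀ t i, x t i = σ ((A *ᵥ x (t - 1) + C *ᵥ z t + ζ) i)) →
          ∀ t, W ⬝ᵥ x t = g fun k => z (t - k)

/-- Sums run two networks in parallel. For a node, the old readout `W` becomes the incoming weights
of one new neuron of top rank, and the delay in `x (t - 1)` produces the shift `z (k + 1)`. -/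
theorem IsReservoirFunctional.isRealizable {n : ℕ} {σ : ℝ → ℝ} {g : (ℕ → Fin n → ℝ) → ℝ}
    (hg : IsReservoirFunctional σ g) : IsRealizable σ g := by
  induction hg with
  | zero => exact ⟨Empty, inferInstance, 0, 0, 0, 0, 0, by simp, by simp⟩
  | smul a _ h =>
    obtain ⟨ι, _, r, A, C, ζ, W, hr, h⟩ := h
    exact ⟨ι, inferInstance, r, A, C, ζ, a • W, hr, fun z x hx t => by
      rw [smul_dotProduct, h z x hx]; rfl⟩
  | add _ _ h₁ h₂ =>
    obtain ⟨ι₁, _, r₁, A₁, C₁, ζ₁, W₁, hr₁, h₁⟩ := h₁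
    obtain ⟨ι₂, _, r₂, A₂, C₂, ζ₂, W₂, hr₂, h₂⟩ := h₂
    refine ⟨ι₁ ⊕ ι₂, inferInstance, Sum.elim r₁ r₂, Matrix.fromBlocks A₁ 0 0 A₂,
      Matrix.fromRows C₁ C₂, Sum.elim ζ₁ ζ₂, Sum.elim W₁ W₂, ?_, fun z x hx t => ?_⟩
    · rintro (i | i) (j | j) hij
      · exact hr₁ i j (by simpa using hij)
      · simp at hij
      · simp at hij
      · exact hr₂ i j (by simpa using hij)
    · have e₁ := h₁ z (fun t => x t ∘ Sum.inl) (fun t i => by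
        simp [hx t (Sum.inl i), Matrix.fromBlocks_mulVec, Matrix.fromRows_mulVec]) t
      have e₂ := h₂ z (fun t => x t ∘ Sum.inr) (fun t i => by
        simp [hx t (Sum.inr i), Matrix.fromBlocks_mulVec, Matrix.fromRows_mulVec]) t
      rw [Pi.add_apply, ← e₁, ← e₂, ← sumElim_dotProduct_sumElim, Sum.elim_comp_inl_inr]
  | node c b _ h =>
    obtain ⟨ι, _, r, A, C, ζ, W, hr, h⟩ := h
    refine ⟨ι ⊕ Unit, inferInstance, Sum.elim r fun _ => Finset.univ.sup r + 1,
      Matrix.fromBlocks A 0 (Matrix.of fun _ => W) 0, Matrix.fromRows C (Matrix.of fun _ => c),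
      Sum.elim ζ fun _ => b, Sum.elim 0 1, ?_, fun z x hx t => ?_⟩
    · rintro (i | i) (j | j) hij
      · exact hr i j (by simpa using hij)
      · simp at hij
      · exact Nat.lt_succ_of_le (Finset.le_sup (f := r) (Finset.mem_univ j))
      · simp at hij
    · have e := h z (fun t => x t ∘ Sum.inl) (fun t i => by
        simp [hx t (Sum.inl i), Matrix.fromBlocks_mulVec, Matrix.fromRows_mulVec]) (t - 1)
      have hW : Sum.elim (0 : ι → ℝ) (1 : Unit → ℝ) ⬝ᵥ x t = x t (Sum.inr ()) := by
        simp [dotProduct]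
      rw [hW, hx]
      congr 1
      have e' : (fun k : ℕ => z (t - 1 - k)) = fun k : ℕ => z (t - ((k + 1 : ℕ) : ℤ)) := by
        ext1 k; congr 1; push_cast; ring
      rw [e'] at e
      rw [← e]
      simp [Matrix.fromBlocks_mulVec, Matrix.fromRows_mulVec, Matrix.mulVec]

section EchoState

variable {n N : ℕ} {σ : ℝ → ℝ} {A : Matrix (Fin N) (Fin N) ℝ} {C : Matrix (Fin N) (Fin n) ℝ}
  {ζ : Fin N → ℝ} {r : Fin N → ℕ}

theorem esnMap_congr_of_rank (hr : ∀ i j, A i j ≠ 0 → r j < r i) {x y : Fin N → ℝ} {m : ℕ}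
    (hxy : ∀ i, r i < m → x i = y i) (z : Fin n → ℝ) {i : Fin N} (hi : r i < m + 1) :
    esnMap σ A C ζ x z i = esnMap σ A C ζ y z i := by
  have : (A *ᵥ x) i = (A *ᵥ y) i := by
    simp only [Matrix.mulVec, dotProduct]
    refine Finset.sum_congr rfl fun j _ => ?_
    by_cases h : A i j = 0
    · simp [h]
    · rw [hxy j (by have := hr i j h; omega)]
  simp only [esnMap, Pi.add_apply, this]

/-- After `m` steps every neuron of rank below `m` has forgotten the initial guess. So iterating the
state equation past the largest rank, here from `0`, reaches a fixed point, and every solution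
coincides with it. -/
theorem echoStateProperty_of_rank (hr : ∀ i j, A i j ≠ 0 → r j < r i) :
    EchoStateProperty (esnMap σ A C ζ) := by
  intro z
  have hR (i : Fin N) : r i < Finset.univ.sup r + 1 :=
    Nat.lt_succ_of_le (Finset.le_sup (f := r) (Finset.mem_univ i))
  let F : (ℤ → Fin N → ℝ) → ℤ → Fin N → ℝ := fun x t => esnMap σ A C ζ (x (t - 1)) (z t)
  have hF (m : ℕ) : ∀ t i, r i < m → F^[m] 0 t i = F^[m + 1] 0 t i := by
    induction m with
    | zero => simp
    | succ m ih =>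
      intro t i hi
      rw [Function.iterate_succ_apply' F m, Function.iterate_succ_apply' F (m + 1)]
      exact esnMap_congr_of_rank hr (ih (t - 1)) _ hi
  refine ⟨F^[Finset.univ.sup r + 1] 0, fun t => ?_, fun y hy => ?_⟩
  · ext i
    rw [hF _ t i (hR i), Function.iterate_succ_apply']
  · have key (m : ℕ) : ∀ t i, r i < m → y t i = F^[m] 0 t i := by
      induction m with
      | zero => simp
      | succ m ih =>
        intro t i hi
        rw [Function.iterate_succ_apply', hy t]
        exact esnMap_congr_of_rank hr (ih (t - 1)) _ hi
    ext t i
    exact key _ t i (hR i)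

end EchoState

theorem IsReservoirFunctional.exists_esn {n : ℕ} {σ : ℝ → ℝ} {g : (ℕ → Fin n → ℝ) → ℝ}
    (hg : IsReservoirFunctional σ g) :
    ∃ (N : ℕ) (C : Matrix (Fin N) (Fin n) ℝ) (ζ : Fin N → ℝ) (A : Matrix (Fin N) (Fin N) ℝ)
      (W : Fin N → ℝ) (hESP : EchoStateProperty (esnMap σ A C ζ)),
      ∀ z t, esnFilter σ A C ζ W hESP z t = g fun k => z (t - k) := by
  obtain ⟨ι, _, r, A, C, ζ, W, hr, h⟩ := hg.isRealizable
  let e := Fintype.equivFin ι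
  refine ⟨Fintype.card ι, C.submatrix e.symm id, ζ ∘ e.symm, A.submatrix e.symm e.symm, W ∘ e.symm,
    echoStateProperty_of_rank (r := r ∘ e.symm) fun i j hij => hr _ _ hij, fun z t => ?_⟩
  set hESP : EchoStateProperty (esnMap σ (A.submatrix e.symm e.symm) (C.submatrix e.symm id)
    (ζ ∘ e.symm)) := echoStateProperty_of_rank (r := r ∘ e.symm) fun i j hij => hr _ _ hij
  have hx := (hESP z).choose_spec.1
  rw [← h z (fun t => (hESP z).choose t ∘ e) (fun t i => ?_) t]
  · simp only [esnFilter, reservoirFilter, linearReadout]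
    rw [comp_equiv_symm_dotProduct]
  · have := congrFun (hx t) (e i)
    rw [Function.comp_apply, this, esnMap]
    congr 1
    simp [Matrix.submatrix_mulVec_equiv, Matrix.mulVec, dotProduct]

/-! ### Transfer to the input process. -/

theorem theorem2 {Ω : Type*} [MeasurableSpace Ω] (P : Measure Ω) [IsProbabilityMeasure P]
    (p : ℝ≥0∞) (hp_one : 1 ≤ p) (hp_top : p ≠ ∞)
    (n : ℕ) (Z : NegTime → Ω → (Fin n → ℝ)) (hZ : ∀ t, Measurable (Z t))
    (H : (NegTime → Fin n → ℝ) → ℝ) (hH : Measurable H)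
    (hHZ : MemLp (fun ω => H (fun t => Z t ω)) p P)
    (σ : ℝ → ℝ) (hσ_nonconst : ¬ ∃ c : ℝ, ∀ x : ℝ, σ x = c) (hσ_cont : Continuous σ)
    (hσ_bdd : Bornology.IsBounded (Set.range σ))
    (ε : ℝ) (hε : 0 < ε) :
    ∃ (N : ℕ) (C : Matrix (Fin N) (Fin n) ℝ) (ζ : Fin N → ℝ)
      (A : Matrix (Fin N) (Fin N) ℝ) (W : Fin N → ℝ)
      (hESP : EchoStateProperty (esnMap σ A C ζ)),
      IsCausal (esnFilter σ A C ζ W hESP) ∧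
      IsTimeInvariant (esnFilter σ A C ζ W hESP) ∧
      MemLp (fun ω => esnFunctional σ A C ζ W hESP (fun t => Z t ω)) p P ∧
      eLpNorm (fun ω => H (fun t => Z t ω) -
        esnFunctional σ A C ζ W hESP (fun t => Z t ω)) p P < ENNReal.ofReal ε := by
  have hneg (k : ℕ) : -(k : ℤ) ≤ 0 := by omega
  -- Time `-k` is re-indexed as lag `k`; `H'` below is `H` in these coordinates.
  set Y : Ω → ℕ → Fin n → ℝ := fun ω k => Z ⟨-k, hneg k⟩ ω with hY
  have hYm : Measurable Y := measurable_pi_lambda _ fun k => hZ _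
  set H' : (ℕ → Fin n → ℝ) → ℝ := fun y => H fun t => y (-t.1).toNat with hH'
  have hH'm : Measurable H' := hH.comp (by fun_prop)
  have hHY (ω : Ω) : H' (Y ω) = H fun t => Z t ω := by
    simp only [hH', hY]
    congr 1
    ext1 t
    congr
    have := t.2
    omega
  have hL : MemLp H' p (P.map Y) := by
    rw [memLp_map_measure_iff hH'm.aestronglyMeasurable hYm.aemeasurable]
    simpa only [Function.comp_def, hHY] using hHZ
  have : IsProbabilityMeasure (P.map Y) := Measure.isProbabilityMeasure_map hYm.aemeasurable
  obtain ⟨g, hg, hlt⟩ := exists_isReservoirFunctional_eLpNorm_sub_lt hp_one hp_top hσ_cont hσ_bdd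
    hσ_nonconst hL (ENNReal.ofReal_pos.2 hε).ne'
  have hgm := hg.measurable hσ_cont.measurable
  obtain ⟨M, hM⟩ := hg.exists_norm_le hσ_bdd
  obtain ⟨N, C, ζ, A, W, hESP, hU⟩ := hg.exists_esn
  have hf (ω : Ω) : esnFunctional σ A C ζ W hESP (fun t => Z t ω) = g (Y ω) := by
    rw [esnFunctional, filterFunctional, hU]
    congr 1
    ext1 k
    simp [extendZero, hY]
  -- The output at `t` is `g` of the inputs at times `t - k`, `k ≥ 0`, which gives causality and
  -- time invariance at once.
  refine ⟨N, C, ζ, A, W, hESP, fun t z w h => ?_, fun τ z => ?_, ?_, ?_⟩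
  · rw [hU, hU]
    congr 1
    ext1 k
    exact h _ (by omega)
  · ext t
    rw [timeDelay, hU, hU]
    congr 1
    ext1 k
    rw [timeDelay]
    congr 1
    ring
  · simp only [hf]
    exact .of_bound (hgm.comp hYm).aestronglyMeasurable M (ae_of_all _ fun ω => hM _)
  · rw [eLpNorm_map_measure (hH'm.sub hgm).aestronglyMeasurable hYm.aemeasurable] at hlt
    simp only [hf, ← hHY]
    exact hlt
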